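/- A probabilistic parallel decision tree of parallelism $q$ on the ground set $\{1,\dots,m\}$ is a rooted tree with three kinds of nodes: randomization nodes, which move to one of their (finitely or countably many) children at random according to a fixed distribution; query nodes, which submit $q$ subsets $B_1,\dots,B_q\subseteq\{1,\dots,m\}$ simultaneously to an independence oracle and branch on the $q$ answers; and leaves, each labelled with an output subset of $\{1,\dots,m\}$; every root-to-leaf path is finite. Run on a matroid $M$ with ground set $\{1,\dots,m\}$, the queries are answered according to whether $B_i$ is independent in $M$, and the number of adaptive rounds is the number of query nodes that are visited. The cographic matroid of a finite multigraph $G$ (loops and parallel edges allowed) is the matroid on the edge set of $G$ whose independent sets are the sets of edges whose complement contains a spanning forest (a maximal acyclic edge set) of $G$. **Corollary.** Any randomized algorithm that uses at most $\mathrm{poly}(m)$ independence queries per round needs $\Omega(\log m)$ adaptive rounds in expectation to find a basis of a cographic matroid on $m$ elements. Precisely: for all constants $c>0$ and $0<\delta\le 1$ there are $a>0$ and $m_0$ such that the following holds for all $m\ge m_0$ and all $q\le m^c$. Let $H$ be a probabilistic parallel decision tree of parallelism $q$ on $\{1,\dots,m\}$ that, on every cographic matroid $M$ with ground set $\{1,\dots,m\}$,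 outputs a basis of $M$ with probability at least $\delta$ (in particular, any $H$ that always outputs a basis, where $\delta=1$). Then there is a cographic matroid $M$ with ground set $\{1,\dots,m\}$ on which the expected number of adaptive rounds of $H$ is at least $a\log m$. -/

import Mathlib

namespace CographicLB

/-- `C` is the edge set of a cycle of the multigraph `G`: there are `k + 1 ≥ 1` distinct vertices
`v 0, …, v k` and distinct edges `e 0, …, e k`, where `e i` joins `v i` to `v (i + 1)` with indices
modulo `k + 1`. A loop is a cycle of length one, two parallel edges form a cycle of length two. -/
def IsCycle {V E : Type} (G : Graph V E) (C : Set E) : Prop :=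
  ∃ (k : ℕ) (v : Fin (k + 1) → V) (e : Fin (k + 1) → E),
    Function.Injective v ∧ Function.Injective e ∧
      (∀ i, G.IsLink (e i) (v i) (v (i + 1))) ∧ C = Set.range e

/-- `F` is a set of edges of `G` that contains no cycle. -/
def IsAcyclic {V E : Type} (G : Graph V E) (F : Set E) : Prop :=
  F ⊆ G.edgeSet ∧ ∀ C, IsCycle G C → ¬ C ⊆ F

/-- A spanning forest of `G`: an inclusionwise maximal acyclic set of edges. -/
def IsSpanningForest {V E : Type} (G : Graph V E) (F : Set E) : Prop :=
  Maximal (IsAcyclic G) F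

/-- `M` is the cographic matroid of the multigraph `G`: its ground set is the edge set of `G`, and
its independent sets are the sets of edges whose complement contains a spanning forest of `G`. -/
def IsCographicMatroidOf {V E : Type} (M : Matroid E) (G : Graph V E) : Prop :=
  M.E = G.edgeSet ∧
    ∀ I : Set E, M.Indep I ↔
      I ⊆ G.edgeSet ∧ ∃ F, IsSpanningForest G F ∧ F ⊆ G.edgeSet \ I

/-- `M` is a cographic matroid on the `m` labelled elements `Fin m`, all of which belong to the
ground set. The underlying finite multigraph may have loops and parallel edges. -/
def IsCographic {m : ℕ} (M : Matroid (Fin m)) : Prop :=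
  M.E = Set.univ ∧
    ∃ (V : Type) (_ : Finite V) (G : Graph V (Fin m)), IsCographicMatroidOf M G

/-- Probabilistic parallel decision trees of parallelism `q` on the ground set `Fin m`.
A `leaf` is labelled with the output set. A `query` node asks the `q` sets `B 0, …, B (q - 1)` in
one round (repetitions allow fewer queries) and branches on the vector of answers. A `random` node
moves to the child `next i` with probability `p i`; a split into `b` branches with probability
`1 / b` each is the case where `p` is uniform on `{0, …, b - 1}`. -/
inductive DecisionTree (m q : ℕ) : Type
  | leaf (B : Finset (Fin m)) : DecisionTree m q
  | query (B : Fin q → Finset (Fin m)) (next : (Fin q → Bool) → DecisionTree m q) :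
      DecisionTree m q
  | random (p : PMF ℕ) (next : ℕ → DecisionTree m q) : DecisionTree m q

open Classical in
/-- The independence oracle of `M`. -/
noncomputable def indOracle {m : ℕ} (M : Matroid (Fin m)) (B : Finset (Fin m)) : Bool :=
  decide (M.Indep (B : Set (Fin m)))

/-- The expected number of rounds, i.e. of query nodes on the path followed by the tree when
queries are answered by the independence oracle of `M`. Randomization nodes are free. -/
noncomputable def expectedRounds {m q : ℕ} (M : Matroid (Fin m)) :
    DecisionTree m q → ENNReal
  | .leaf _ => 0
  | .query B next => 1 + expectedRounds M (next fun i => indOracle M (B i))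
  | .random p next => ∑' i, p i * expectedRounds M (next i)

open Classical in
/-- The probability that the tree, run with the independence oracle of `M`, outputs a basis
of `M`. -/
noncomputable def successProb {m q : ℕ} (M : Matroid (Fin m)) :
    DecisionTree m q → ENNReal
  | .leaf B => if M.IsBase (B : Set (Fin m)) then 1 else 0
  | .query B next => successProb M (next fun i => indOracle M (B i))
  | .random p next => ∑' i, p i * successProb M (next i)

end CographicLB

namespace CographicLB

open Set Function

/-! ### Bundles of parallel edges -/

/-! The hard instances are disjoint bundles of parallel edges. A labelling `f` assigns each element
to a bundle. If `f` is surjective, a set is independent exactly when its complement meets every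
bundle, and the complement of a basis is a transversal of the bundles.

There are `k + 1` levels of `n` labels, with `k` of order `log m`. Elements receive labels
independently, a label of level `i` having weight `K ^ i`, so low-level bundles are the small ones.
Suppose the levels below `j` are known, and let `A` be the unrevealed elements outside a queried
set. If `A` is large, it almost surely meets all bundles of level above `j`, so levels up to `j`
determine the answer. If `A` is smaller, by coupon collection it almost surely misses one of the `n`
bundles of level `j`, and the answer is "dependent". The factor `K` between consecutive levels
leaves no gap between the two cases (`exists_prediction`). A round therefore teaches essentially
nothing beyond level `j`, and while a level remains hidden no fixed output is likely to be a basis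
(`sum_basis_le`).

`sum_mul_truncSuccess_le` turns these one-round statements into a bound for adaptive trees.
Averaging over labellings and Markov's inequality (`le_of_forall_expectedRounds_lt`) then bound the
expected number of rounds on some instance. Probabilities are kept as unnormalised weights, so
conditioning means comparing sums over fibers of `reveal`. -/

/-- The multigraph that has a bundle of parallel edges for every label: the edge `e` joins the two
vertices carrying the label `f e`. -/
def bundleGraph {E L : Type} (f : E → L) : Graph (L × Bool) E where
  vertexSet := univ
  IsLink e x y := x.1 = f e ∧ y.1 = f e ∧ x.2 ≠ y.2
  isLink_symm _ _ := ⟨fun _ _ h => ⟨h.2.1, h.1, h.2.2.symm⟩⟩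
  eq_or_eq_of_isLink_of_isLink := by
    rintro e ⟨x, a⟩ ⟨y, b⟩ ⟨z, c⟩ ⟨w, d⟩ ⟨h1, h2, h3⟩ ⟨h4, h5, h6⟩
    simp only at h1 h2 h3 h4 h5 h6
    subst h1 h4 h5
    cases a <;> cases b <;> cases c <;> cases d <;> simp_all

lemma bundleGraph_isLink {E L : Type} {f : E → L} {e : E} {x y : L × Bool} :
    (bundleGraph f).IsLink e x y ↔ x.1 = f e ∧ y.1 = f e ∧ x.2 ≠ y.2 := Iff.rfl

lemma bundleGraph_edgeSet {E L : Type} (f : E → L) : (bundleGraph f).edgeSet = univ :=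
  eq_univ_of_forall fun e => ⟨(f e, false), (f e, true), by simp⟩

/-- Two edges with a common label form a 2-cycle. Conversely there are no loops, and consecutive
edges of a longer cycle share a vertex, hence a label. -/
lemma isAcyclic_bundleGraph_iff {E L : Type} (f : E → L) (F : Set E) :
    IsAcyclic (bundleGraph f) F ↔ InjOn f F := by
  refine ⟨fun h e he e' he' hee => ?_, fun h => ⟨by simp [bundleGraph_edgeSet], ?_⟩⟩
  · by_contra hne
    refine h.2 {e, e'} ⟨1, ![(f e, false), (f e, true)], ![e, e'], ?_, ?_, ?_, ?_⟩ ?_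
    · intro i j; fin_cases i <;> fin_cases j <;> simp
    · intro i j; fin_cases i <;> fin_cases j <;> simp [hne, Ne.symm hne]
    · intro i; fin_cases i <;> simp [bundleGraph_isLink, hee]
    · simp [Matrix.range_cons, pair_comm e e']
    · simp [insert_subset_iff, he, he']
  · rintro C ⟨k, v, e, -, he, hlink, rfl⟩ hC
    rcases k with _ | k
    · exact (hlink 0).2.2 rfl
    · have h01 : f (e 0) = f (e (0 + 1)) := (hlink 0).2.1.symm.trans (hlink (0 + 1)).1
      have := he (h (hC ⟨0, rfl⟩) (hC ⟨_, rfl⟩) h01)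
      simp at this

/-- The cographic matroid of `bundleGraph f`. -/
def bundleMatroid {E L : Type} (f : E → L) : Matroid E := ((Matroid.freeOn univ).comap f)✶

lemma isBase_comap_free_iff {E L : Type} (f : E → L) (F : Set E) :
    ((Matroid.freeOn (univ : Set L)).comap f).IsBase F ↔ Maximal (fun F => InjOn f F) F := by
  have : ((Matroid.freeOn (univ : Set L)).comap f).Indep = fun F => InjOn f F :=
    funext fun F => by simp
  rw [Matroid.isBase_iff_maximal_indep, this]

/-- Spanning forests of the bundle graph are the maximal sets on which `f` is injective, which are
the bases of the matroid being dualised. Surjectivity plays no role, so every labelling gives a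
legitimate instance. -/
lemma isCographic_bundleMatroid {m : ℕ} {L : Type} [Finite L] (f : Fin m → L) :
    IsCographic (bundleMatroid f) := by
  refine ⟨by simp [bundleMatroid], L × Bool, inferInstance, bundleGraph f, ?_, fun I => ?_⟩
  · simp [bundleMatroid, bundleGraph_edgeSet]
  · have : IsAcyclic (bundleGraph f) = fun F => InjOn f F :=
      funext fun F => propext (isAcyclic_bundleGraph_iff f F)
    simp only [bundleMatroid, Matroid.dual_indep_iff_exists', isBase_comap_free_iff,
      IsSpanningForest, this, bundleGraph_edgeSet, Matroid.comap_ground_eq,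
      Matroid.freeOn_ground, preimage_univ, ← compl_eq_univ_sdiff, subset_compl_iff_disjoint_left]

lemma maximal_injOn_iff {E L : Type} {f : E → L} (hf : Surjective f) (F : Set E) :
    Maximal (fun F => InjOn f F) F ↔ InjOn f F ∧ ∀ l, ∃ e ∈ F, f e = l := by
  refine ⟨fun h => ⟨h.1, fun l => ?_⟩, fun h => ⟨h.1, fun F' hF' hle e he => ?_⟩⟩
  · by_contra! hl
    obtain ⟨e, rfl⟩ := hf l
    have he : e ∉ F := fun he => hl e he rfl
    refine he (h.2 (y := insert e F) ?_ (subset_insert e F) (mem_insert e F))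
    exact (injOn_insert he).2 ⟨h.1, fun ⟨e', he', hee⟩ => hl e' he' hee⟩
  · obtain ⟨e', he', hee⟩ := h.2 (f e)
    exact hF' (hle he') he hee ▸ he'

/-- Surjectivity matters because the right side asks for every label, while the matroid only sees
the labels in use. -/
lemma bundleMatroid_indep_iff {E L : Type} {f : E → L} (hf : Surjective f) (I : Set E) :
    (bundleMatroid f).Indep I ↔ ∀ l, ∃ e ∉ I, f e = l := by
  simp only [bundleMatroid, Matroid.dual_indep_iff_exists', isBase_comap_free_iff,
    maximal_injOn_iff hf]
  refine ⟨fun ⟨_, B, ⟨_, hB⟩, hd⟩ l => ?_, fun h => ⟨by simp, ?_⟩⟩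
  · obtain ⟨e, he, hl⟩ := hB l
    exact ⟨e, fun h => disjoint_left.1 hd h he, hl⟩
  · choose s hs hfs using h
    refine ⟨range s, ⟨?_, fun l => ⟨s l, ⟨l, rfl⟩, hfs l⟩⟩, ?_⟩
    · rintro _ ⟨a, rfl⟩ _ ⟨b, rfl⟩ hab
      rw [hfs, hfs] at hab
      rw [hab]
    · rw [disjoint_right]
      rintro _ ⟨a, rfl⟩
      exact hs a

lemma injOn_compl_of_bundleMatroid_isBase {E L : Type} {f : E → L} {B : Set E}
    (hB : (bundleMatroid f).IsBase B) : InjOn f Bᶜ := by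
  have := Matroid.IsBase.compl_isBase_of_dual hB
  rw [isBase_comap_free_iff] at this
  simpa [compl_eq_univ_sdiff] using this.1

/-! ### Truncated runs of decision trees -/

open Classical in
/-- The probability that the tree, run with oracle `o`, makes at most `r` rounds and outputs a set
with the property `g`. -/
noncomputable def truncSuccess {m q : ℕ} (o : Finset (Fin m) → Bool) (g : Finset (Fin m) → Prop) :
    DecisionTree m q → ℕ → ENNReal
  | .leaf B, _ => if g B then 1 else 0
  | .query _ _, 0 => 0
  | .query B next, r + 1 => truncSuccess o g (next fun i => o (B i)) r
  | .random p next, r => ∑' i, p i * truncSuccess o g (next i) r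

/-- The probability that the tree, run with oracle `o`, makes more than `r` rounds. -/
noncomputable def exceedProb {m q : ℕ} (o : Finset (Fin m) → Bool) :
    DecisionTree m q → ℕ → ENNReal
  | .leaf _, _ => 0
  | .query _ _, 0 => 1
  | .query B next, r + 1 => exceedProb o (next fun i => o (B i)) r
  | .random p next, r => ∑' i, p i * exceedProb o (next i) r

variable {m q : ℕ}

lemma pmf_tsum_mul_le (p : PMF ℕ) {u : ℕ → ENNReal} {b : ENNReal} (h : ∀ i, u i ≤ b) :
    ∑' i, p i * u i ≤ b :=
  calc ∑' i, p i * u i ≤ ∑' i, p i * b := ENNReal.tsum_le_tsum fun i => by gcongr; exact h i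
    _ = b := by rw [ENNReal.tsum_mul_right, p.tsum_coe, one_mul]

lemma truncSuccess_le_one (o : Finset (Fin m) → Bool) (g : Finset (Fin m) → Prop)
    (H : DecisionTree m q) : ∀ r, truncSuccess o g H r ≤ 1 := by
  induction H with
  | leaf B => intro r; rw [truncSuccess]; split_ifs <;> simp
  | query B next ih =>
    rintro (_ | r) <;> rw [truncSuccess]
    · simp
    · exact ih _ r
  | random p next ih => intro r; rw [truncSuccess]; exact pmf_tsum_mul_le p fun i => ih i r

lemma exceedProb_le_one (o : Finset (Fin m) → Bool)
    (H : DecisionTree m q) : ∀ r, exceedProb o H r ≤ 1 := by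
  induction H with
  | leaf B => intro r; rw [exceedProb]; simp
  | query B next ih =>
    rintro (_ | r) <;> rw [exceedProb]
    exact ih _ r
  | random p next ih => intro r; rw [exceedProb]; exact pmf_tsum_mul_le p fun i => ih i r

lemma successProb_le_one (M : Matroid (Fin m)) (H : DecisionTree m q) : successProb M H ≤ 1 := by
  induction H with
  | leaf B => rw [successProb]; split_ifs <;> simp
  | query B next ih => rw [successProb]; exact ih _
  | random p next ih => rw [successProb]; exact pmf_tsum_mul_le p ih

lemma successProb_le_truncSuccess_add_exceedProb (M : Matroid (Fin m)) (H : DecisionTree m q) :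
    ∀ r, successProb M H ≤
      truncSuccess (indOracle M) (fun B => M.IsBase (B : Set (Fin m))) H r +
        exceedProb (indOracle M) H r := by
  induction H with
  | leaf B => intro r; rw [successProb, truncSuccess, exceedProb, add_zero]
  | query B next ih =>
    rintro (_ | r)
    · rw [truncSuccess, exceedProb, zero_add]
      exact successProb_le_one _ _
    · rw [successProb, truncSuccess, exceedProb]; exact ih _ r
  | random p next ih =>
    intro r
    rw [successProb, truncSuccess, exceedProb, ← ENNReal.tsum_add]
    refine ENNReal.tsum_le_tsum fun i => ?_
    rw [← mul_add]
    gcongr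
    exact ih i r

/-- Markov's inequality: exceeding `r` rounds means making at least `r + 1`. -/
lemma mul_exceedProb_le_expectedRounds (M : Matroid (Fin m)) (H : DecisionTree m q) :
    ∀ r : ℕ, ((r + 1 : ℕ) : ENNReal) * exceedProb (indOracle M) H r ≤ expectedRounds M H := by
  induction H with
  | leaf B => intro r; rw [exceedProb]; simp
  | query B next ih =>
    rintro (_ | r) <;> rw [exceedProb, expectedRounds]
    · simp
    · rw [Nat.cast_succ, add_mul, one_mul, add_comm]
      exact add_le_add (exceedProb_le_one _ _ _) (ih _ r)
  | random p next ih =>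
    intro r
    rw [exceedProb, expectedRounds, ← ENNReal.tsum_mul_left]
    refine ENNReal.tsum_le_tsum fun i => ?_
    rw [mul_left_comm]
    gcongr
    exact ih i r

lemma truncSuccess_mono {o : Finset (Fin m) → Bool} {g g' : Finset (Fin m) → Prop}
    (h : ∀ B, g B → g' B) (H : DecisionTree m q) :
    ∀ r, truncSuccess o g H r ≤ truncSuccess o g' H r := by
  induction H with
  | leaf B =>
    intro r
    rw [truncSuccess, truncSuccess]
    by_cases hB : g B
    · simp [hB, h B hB]
    · simp [hB]
  | query B next ih =>
    rintro (_ | r) <;> rw [truncSuccess, truncSuccess]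
    exact ih _ r
  | random p next ih =>
    intro r
    rw [truncSuccess, truncSuccess]
    exact ENNReal.tsum_le_tsum fun i => by gcongr; exact ih i r

/-! ### Adaptive lower bound from round-by-round predictions -/

open Finset in
/-- If the oracle `o f` of a random instance `f` can be predicted, one round at a time, from what
`rev (j + 1) f` reveals, and if no leaf is likely to be correct, then few rounds do not suffice. -/
lemma sum_mul_truncSuccess_le {Ω S : Type*} [Fintype Ω] [DecidableEq S] (W : Ω → ENNReal)
    (o : Ω → Finset (Fin m) → Bool) (g : Ω → Finset (Fin m) → Prop)
    [∀ B, DecidablePred fun f => g f B] (rev : ℕ → Ω → S)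
    (hrev : ∀ j f f', rev (j + 1) f = rev (j + 1) f' → rev j f = rev j f') (k : ℕ) (ε : ENNReal)
    (hleaf : ∀ j ≤ k, ∀ ρ B,
      ∑ f with rev j f = ρ ∧ g f B, W f ≤ ε * ∑ f with rev j f = ρ, W f)
    (hquery : ∀ j < k, ∀ ρ, ∀ B : Fin q → Finset (Fin m), ∃ a : S → Fin q → Bool,
      ∑ f with rev j f = ρ ∧ (fun i => o f (B i)) ≠ a (rev (j + 1) f), W f ≤
        ε * ∑ f with rev j f = ρ, W f)
    (H : DecisionTree m q) :
    ∀ r j ρ, j + r = k → ∑ f with rev j f = ρ, W f * truncSuccess (o f) (g f) H r ≤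
      (r + 1) * ε * ∑ f with rev j f = ρ, W f := by
  induction H with
  | leaf B =>
    intro r j ρ hjr
    simp only [truncSuccess, mul_ite, mul_one, mul_zero]
    rw [← sum_filter, filter_filter]
    refine (hleaf j (by omega) ρ B).trans ?_
    gcongr
    exact le_mul_of_one_le_left' (by simp)
  | query B next ih =>
    rintro (_ | r) j ρ hjr
    · simp [truncSuccess]
    obtain ⟨a, ha⟩ := hquery j (by omega) ρ B
    -- Either the prediction fails, at the cost of the whole weight, or the run continues in the
    -- child selected by the prediction.
    have hpt : ∀ f, W f * truncSuccess (o f) (g f) (.query B next) (r + 1) ≤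
        (if (fun i => o f (B i)) ≠ a (rev (j + 1) f) then W f else 0) +
          W f * truncSuccess (o f) (g f) (next (a (rev (j + 1) f))) r := by
      intro f
      rw [truncSuccess]
      split_ifs with h
      · exact le_add_right (mul_le_of_le_one_right' (truncSuccess_le_one _ _ _ _))
      · rw [not_not] at h
        rw [h, zero_add]
    -- By `hrev`, a fiber of `rev j` is a disjoint union of fibers of `rev (j + 1)`. On each of them
    -- the predicted child is constant, so the induction hypothesis applies.
    have hsplit : ∀ φ : Ω → ENNReal, ∑ f with rev j f = ρ, φ f =
        ∑ ρ' ∈ ({f | rev j f = ρ} : Finset Ω).image (rev (j + 1)),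
          ∑ f with rev (j + 1) f = ρ', φ f := by
      intro φ
      rw [← sum_fiberwise_of_maps_to (fun f hf => mem_image_of_mem (rev (j + 1)) hf)]
      refine sum_congr rfl fun ρ' hρ' => ?_
      obtain ⟨f₀, hf₀, rfl⟩ := mem_image.1 hρ'
      congr 1
      ext f
      simp only [mem_filter, Finset.mem_univ, true_and] at hf₀ ⊢
      exact ⟨fun h => h.2, fun h => ⟨(hrev j _ _ h).trans hf₀, h⟩⟩
    have hmain : ∑ f with rev j f = ρ,
        W f * truncSuccess (o f) (g f) (next (a (rev (j + 1) f))) r ≤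
          (r + 1) * ε * ∑ f with rev j f = ρ, W f := by
      rw [hsplit, hsplit W, mul_sum]
      refine sum_le_sum fun ρ' _ => ?_
      refine le_trans (le_of_eq ?_) (ih (a ρ') r (j + 1) ρ' (by omega))
      refine sum_congr rfl fun f hf => ?_
      rw [(mem_filter.1 hf).2]
    calc _ ≤ _ := sum_le_sum fun f _ => hpt f
      _ = (∑ f with rev j f = ρ ∧ (fun i => o f (B i)) ≠ a (rev (j + 1) f), W f) + _ := by
        rw [sum_add_distrib, ← sum_filter, filter_filter]
      _ ≤ ε * ∑ f with rev j f = ρ, W f + (r + 1) * ε * ∑ f with rev j f = ρ, W f :=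
        add_le_add ha hmain
      _ = _ := by push_cast; ring
  | random p next ih =>
    intro r j ρ hjr
    simp only [truncSuccess, ← ENNReal.tsum_mul_left]
    rw [← Summable.tsum_finsetSum fun _ _ => ENNReal.summable]
    refine le_trans (le_of_eq ?_) (pmf_tsum_mul_le p fun i => ih i r j ρ hjr)
    refine tsum_congr fun i => ?_
    rw [mul_sum]
    exact sum_congr rfl fun f _ => mul_left_comm _ _ _

end CographicLB

namespace CographicLB

open Finset

/-! ### Product weights -/

/-- The union bound for weights. -/
lemma sum_filter_le_sum_sum {Ω I : Type*} [Fintype Ω] {φ : Ω → ℝ} (hφ : ∀ f, 0 ≤ φ f)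
    {p : Ω → Prop} [DecidablePred p] {s : Finset I} {r : I → Ω → Prop}
    [∀ i, DecidablePred (r i)] (h : ∀ f, p f → ∃ i ∈ s, r i f) :
    ∑ f with p f, φ f ≤ ∑ i ∈ s, ∑ f with r i f, φ f := by
  simp only [sum_filter]
  rw [sum_comm]
  refine sum_le_sum fun f _ => ?_
  have hnn : ∀ i ∈ s, 0 ≤ if r i f then φ f else 0 := fun i _ => by
    split_ifs
    exacts [hφ f, le_rfl]
  split_ifs with hp
  · obtain ⟨i, hi, hr⟩ := h f hp
    refine le_trans ?_ (single_le_sum hnn hi)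
    rw [if_pos hr]
  · exact sum_nonneg hnn

section ProductWeight

variable {ι L : Type*} [Fintype ι] [DecidableEq ι] [DecidableEq L] (w : L → ℝ)

/-- The weight of the functions in a box that miss the label `l` on the positions `A`. -/
lemma sum_prod_avoid (t : ι → Finset L) {R : Finset L} {l : L} (hl : l ∈ R)
    (hT : ∑ x ∈ R, w x ≠ 0) (A : Finset ι) (hA : ∀ e ∈ A, t e = R) :
    ∑ f ∈ Fintype.piFinset t with ∀ e ∈ A, f e ≠ l, ∏ e, w (f e) =
      (1 - w l / ∑ x ∈ R, w x) ^ #A * ∑ f ∈ Fintype.piFinset t, ∏ e, w (f e) := by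
  -- Avoiding `l` on `A` cuts out a smaller box, and the weight of a box factorises over positions.
  have h : ({f ∈ Fintype.piFinset t | ∀ e ∈ A, f e ≠ l} : Finset (ι → L)) =
      Fintype.piFinset fun e => if e ∈ A then (t e).erase l else t e := by
    ext f
    simp only [mem_filter, Fintype.mem_piFinset, ← forall_and]
    refine forall_congr' fun e => ?_
    split_ifs with he <;> simp [he, and_comm]
  rw [h, ← prod_univ_sum, ← prod_univ_sum, ← prod_const,
    ← univ_inter A, ← prod_ite_mem, ← prod_mul_distrib]
  refine prod_congr rfl fun e _ => ?_
  simp only [mem_inter, mem_univ, true_and]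
  split_ifs with he
  · rw [hA e he, sum_erase_eq_sub hl]
    field_simp
  · rw [one_mul]

lemma sum_piFinset_eq_sum_update (t : ι → Finset L) (a : ι) (φ : (ι → L) → ℝ) :
    ∑ f ∈ Fintype.piFinset t, φ f =
      ∑ l ∈ t a, ∑ f ∈ Fintype.piFinset (Function.update t a {l}), φ f := by
  rw [← sum_fiberwise_of_maps_to (g := fun f => f a) fun f hf => Fintype.mem_piFinset.1 hf a]
  refine sum_congr rfl fun l hl => ?_
  congr 1
  ext f
  simp only [mem_filter, Fintype.mem_piFinset]
  refine ⟨fun ⟨h, hfa⟩ e => ?_, fun h => ?_⟩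
  · rcases eq_or_ne e a with rfl | he
    · simp [hfa]
    · simpa [Function.update_of_ne he] using h e
  · have ha : f a = l := by simpa using h a
    refine ⟨fun e => ?_, ha⟩
    rcases eq_or_ne e a with rfl | he
    · rwa [ha]
    · simpa [Function.update_of_ne he] using h e

/-- Coupon collection: the weight of the functions in a box that hit all labels of `S` on the
positions `A`, compared with the product bound for independent labels. -/
lemma sum_prod_hit_le (hw : ∀ l, 0 ≤ w l) {R : Finset L} (hT : 0 < ∑ x ∈ R, w x) {x : ℝ}
    (hx : 0 ≤ x) (A : Finset ι) : ∀ (t : ι → Finset L) (S : Finset L), (∀ e ∈ A, t e = R) →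
      S ⊆ R → (∀ l ∈ S, w l = x) → x ≤ ∑ x ∈ R, w x →
      ∑ f ∈ Fintype.piFinset t with ∀ l ∈ S, ∃ e ∈ A, f e = l, ∏ e, w (f e) ≤
        (1 - (1 - x / ∑ x ∈ R, w x) ^ #A) ^ #S * ∑ f ∈ Fintype.piFinset t, ∏ e, w (f e) := by
  set T := ∑ x ∈ R, w x with hTdef
  have hWnn : ∀ f : ι → L, 0 ≤ ∏ e, w (f e) := fun f => prod_nonneg fun e _ => hw _
  induction A using Finset.induction_on with
  | empty =>
    intro t S _ _ _ _
    rcases S.eq_empty_or_nonempty with rfl | ⟨l, hl⟩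
    · simp
    · have h0 : ({f ∈ Fintype.piFinset t | ∀ l ∈ S, ∃ e ∈ (∅ : Finset ι), f e = l} :
          Finset (ι → L)) = ∅ := by
        refine filter_eq_empty_iff.2 fun f _ h => ?_
        simpa using h l hl
      rw [h0, sum_empty]
      simp [(card_pos.2 ⟨l, hl⟩).ne']
  | insert a A ha ih =>
    intro t S ht hS hSx hxT
    set X := 1 - (1 - x / T) ^ #A with hX
    have hy0 : 0 ≤ 1 - x / T := sub_nonneg.2 ((div_le_one hT).2 hxT)
    have hy1 : 1 - x / T ≤ 1 := by have := div_nonneg hx hT.le; linarith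
    have hX0 : 0 ≤ X := sub_nonneg.2 (pow_le_one₀ hy0 hy1)
    have hX1 : X ≤ 1 := by have := pow_nonneg hy0 #A; linarith
    set P := ∏ e ∈ univ.erase a, ∑ l ∈ t e, w l with hP
    have hP0 : 0 ≤ P := prod_nonneg fun e _ => sum_nonneg fun l _ => hw l
    have hupd : ∀ l, ∑ f ∈ Fintype.piFinset (Function.update t a {l}), ∏ e, w (f e) =
        w l * P := by
      intro l
      rw [← prod_univ_sum, ← mul_prod_erase univ _ (mem_univ a)]
      congr 1
      · simp
      · exact prod_congr rfl fun e he => by rw [Function.update_of_ne (ne_of_mem_erase he)]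
    have htot : ∑ f ∈ Fintype.piFinset t, ∏ e, w (f e) = T * P := by
      rw [← prod_univ_sum, ← mul_prod_erase univ _ (mem_univ a), ht a (mem_insert_self a A)]
    -- Condition on the label `l` of the new position `a`: the positions in `A` must still hit
    -- `S.erase l`, which has one label fewer exactly when `l ∈ S`.
    have hstep : ∀ l ∈ R, ∑ f ∈ Fintype.piFinset (Function.update t a {l}),
        (if ∀ l ∈ S, ∃ e ∈ insert a A, f e = l then ∏ e, w (f e) else 0) ≤
          (if l ∈ S then X ^ (#S - 1) else X ^ #S) * (w l * P) := by
      intro l _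
      have key := ih (Function.update t a {l}) (S.erase l)
        (fun e he => by
          rw [Function.update_of_ne (ne_of_mem_of_not_mem he ha), ht e (mem_insert_of_mem he)])
        ((erase_subset l S).trans hS) (fun l' hl' => hSx l' (mem_of_mem_erase hl')) hxT
      rw [hupd, sum_filter, card_erase_eq_ite] at key
      refine le_trans (sum_le_sum fun f hf => ?_) (key.trans_eq ?_)
      · have hfa : f a = l := by simpa using Fintype.mem_piFinset.1 hf a
        split_ifs with h1 h2 h2
        · exact le_rfl
        · refine absurd (fun l' hl' => ?_) h2
          obtain ⟨e, he, hel⟩ := h1 l' (mem_of_mem_erase hl')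
          rcases mem_insert.1 he with rfl | he
          · exact absurd (hel.symm.trans hfa) (ne_of_mem_erase hl')
          · exact ⟨e, he, hel⟩
        · exact hWnn f
        · exact le_rfl
      · split_ifs <;> rfl
    rw [sum_filter, sum_piFinset_eq_sum_update t a, ht a (mem_insert_self a A)]
    refine (sum_le_sum hstep).trans ?_
    have hcard : ∑ l ∈ S, w l = #S * x := by rw [sum_congr rfl hSx]; simp
    have hrest : ∑ l ∈ R \ S, w l = T - #S * x := by
      rw [← hcard, hTdef, ← sum_sdiff hS]; ring
    have hsum : ∑ l ∈ R, (if l ∈ S then X ^ (#S - 1) else X ^ #S) * (w l * P) =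
        (X ^ #S * (T - #S * x) + X ^ (#S - 1) * (#S * x)) * P := by
      rw [← sum_sdiff hS, ← hrest, ← hcard, mul_sum, mul_sum, add_mul, sum_mul, sum_mul]
      congr 1
      · refine sum_congr rfl fun l hl => ?_
        rw [if_neg (mem_sdiff.1 hl).2, mul_assoc]
      · refine sum_congr rfl fun l hl => ?_
        rw [if_pos hl, mul_assoc]
    rw [hsum, htot, card_insert_of_notMem ha, ← mul_assoc (_ ^ #S) T P]
    refine mul_le_mul_of_nonneg_right ?_ hP0
    have hY : 1 - (1 - x / T) ^ (#A + 1) = X + x / T * (1 - X) := by rw [hX, pow_succ]; ring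
    rw [hY]
    -- Averaging over `l` gives the two leading terms of the binomial expansion of the target, so a
    -- Bernoulli-type inequality replaces any appeal to negative correlation.
    have hbern : X ^ #S + #S * X ^ (#S - 1) * (x / T * (1 - X)) ≤
        (X + x / T * (1 - X)) ^ #S :=
      pow_add_mul_le_add_pow hX0 (by
        have := mul_nonneg (div_nonneg hx hT.le) (sub_nonneg.2 hX1); linarith) #S
    refine le_trans (le_of_eq ?_) (mul_le_mul_of_nonneg_right hbern hT.le)
    rcases Nat.eq_zero_or_pos #S with h0 | h0
    · simp [h0]
    · obtain ⟨s, hs⟩ := Nat.exists_eq_succ_of_ne_zero h0.ne'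
      rw [hs, Nat.succ_sub_one, pow_succ]
      field_simp
      ring

end ProductWeight
end CographicLB

namespace CographicLB

open Finset

/-! ### Labels arranged in levels -/

/-- The labels: `k + 1` levels of `n` labels each. -/
abbrev Label (k n : ℕ) : Type := Fin (k + 1) × Fin n

section Levels

variable {k n m : ℕ}

/-- The weight of a label grows geometrically with its level. -/
noncomputable def labelWeight (K : ℝ) (l : Label k n) : ℝ := K ^ (l.1 : ℕ)

/-- The label, if its level is below `j`. -/
def revealBelow (j : ℕ) (l : Label k n) : Option (Label k n) :=
  if (l.1 : ℕ) < j then some l else none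

/-- The labels of level at least `j`. -/
def upperLabels (k n j : ℕ) : Finset (Label k n) := {l | revealBelow j l = none}

/-- The total weight of the labels of level at least `j`. -/
noncomputable def upperWeight (k n : ℕ) (K : ℝ) (j : ℕ) : ℝ :=
  ∑ l ∈ upperLabels k n j, labelWeight K l

/-- The weight of a labelling. -/
noncomputable def labellingWeight (K : ℝ) (f : Fin m → Label k n) : ℝ :=
  ∏ e, labelWeight K (f e)

/-- What is known of a labelling once the levels below `j` are revealed. -/
def reveal (j : ℕ) (f : Fin m → Label k n) : Fin m → Option (Label k n) :=
  fun e => revealBelow j (f e)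

/-- Every label is used outside `B`. -/
def HitsOutside (f : Fin m → Label k n) (B : Finset (Fin m)) : Prop := ∀ l, ∃ e ∉ B, f e = l

instance (f : Fin m → Label k n) (B : Finset (Fin m)) : Decidable (HitsOutside f B) := by
  unfold HitsOutside; infer_instance

lemma sum_labelWeight_upperLabels (K : ℝ) (j : ℕ) :
    ∑ l ∈ upperLabels k n j, labelWeight K l = upperWeight k n K j := rfl

lemma prod_labelWeight (K : ℝ) (f : Fin m → Label k n) :
    ∏ e, labelWeight K (f e) = labellingWeight K f := rfl

lemma revealBelow_eq_none {j : ℕ} {l : Label k n} : revealBelow j l = none ↔ j ≤ (l.1 : ℕ) := by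
  unfold revealBelow; split_ifs with h <;> simp <;> omega

lemma revealBelow_eq_some {j : ℕ} {l l' : Label k n} :
    revealBelow j l = some l' ↔ (l'.1 : ℕ) < j ∧ l = l' := by
  unfold revealBelow
  split_ifs with h
  · simp only [Option.some.injEq]
    exact ⟨fun e => ⟨e ▸ h, e⟩, fun e => e.2⟩
  · simp only [false_iff, not_and]
    rintro h' rfl
    exact h h'

lemma mem_upperLabels {j : ℕ} {l : Label k n} : l ∈ upperLabels k n j ↔ j ≤ (l.1 : ℕ) := by
  simp [upperLabels, revealBelow_eq_none]

lemma reveal_eq_of_succ {j : ℕ} {f f' : Fin m → Label k n}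
    (h : reveal (j + 1) f = reveal (j + 1) f') : reveal j f = reveal j f' := by
  funext e
  have he : revealBelow (j + 1) (f e) = revealBelow (j + 1) (f' e) := congrFun h e
  by_cases h1 : ((f' e).1 : ℕ) < j + 1
  · rw [(revealBelow_eq_some (l' := f' e)).2 ⟨h1, rfl⟩, revealBelow_eq_some] at he
    simp only [reveal, he.2]
  · rw [revealBelow_eq_none.2 (by omega : j + 1 ≤ ((f' e).1 : ℕ)), revealBelow_eq_none] at he
    simp only [reveal]
    rw [revealBelow_eq_none.2 (by omega), revealBelow_eq_none.2 (by omega)]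

variable {K : ℝ}

lemma labelWeight_pos (hK : 1 ≤ K) (l : Label k n) : 0 < labelWeight K l :=
  pow_pos (by linarith) _

lemma labellingWeight_pos (hK : 1 ≤ K) (f : Fin m → Label k n) : 0 < labellingWeight K f :=
  prod_pos fun _ _ => labelWeight_pos hK _

lemma card_mul_le_upperWeight (hK : 1 ≤ K) (j : ℕ) :
    #(upperLabels k n j) * K ^ j ≤ upperWeight k n K j := by
  rw [← nsmul_eq_mul]
  exact card_nsmul_le_sum _ _ _ fun l hl => pow_le_pow_right₀ hK (mem_upperLabels.1 hl)

lemma upperWeight_pos (hK : 1 ≤ K) {j : ℕ} (hj : j ≤ k) (hn : 0 < n) :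
    0 < upperWeight k n K j :=
  sum_pos (fun l _ => labelWeight_pos hK l)
    ⟨(⟨j, by omega⟩, ⟨0, hn⟩), mem_upperLabels.2 le_rfl⟩

/-- The labels of level `j`. -/
def levelLabels (k n j : ℕ) : Finset (Label k n) := {l | (l.1 : ℕ) = j}

lemma card_levelLabels {j : ℕ} (hj : j ≤ k) : #(levelLabels k n j) = n := by
  have : levelLabels k n j = ({⟨j, by omega⟩} : Finset (Fin (k + 1))) ×ˢ univ := by
    ext ⟨i, p⟩
    simp only [levelLabels, mem_filter, mem_univ, true_and, mem_product, mem_singleton, and_true,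
      Fin.ext_iff]
  rw [this]
  simp

lemma levelLabels_subset (j : ℕ) : levelLabels k n j ⊆ upperLabels k n j := fun _ hl =>
  mem_upperLabels.2 (mem_filter.1 hl).2.ge

lemma le_card_upperLabels {j : ℕ} (hj : j ≤ k) : n ≤ #(upperLabels k n j) :=
  (card_levelLabels hj).symm.le.trans (card_le_card (levelLabels_subset j))

/-! ### Conditional weights: a fiber of `reveal` is a box, so hidden labels stay independent. -/

lemma fiber_reveal_eq (j : ℕ) (ρ : Fin m → Option (Label k n)) :
    ({f | reveal j f = ρ} : Finset (Fin m → Label k n)) =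
      Fintype.piFinset fun e => ({l | revealBelow j l = ρ e} : Finset (Label k n)) := by
  ext f
  simp [reveal, funext_iff]

/-- The total weight of the labellings compatible with what has been revealed. -/
noncomputable def fiberWeight (K : ℝ) (j : ℕ) (ρ : Fin m → Option (Label k n)) : ℝ :=
  ∑ f with reveal j f = ρ, labellingWeight K f

lemma fiberWeight_nonneg (hK : 1 ≤ K) (j : ℕ) (ρ : Fin m → Option (Label k n)) :
    0 ≤ fiberWeight K j ρ := sum_nonneg fun f _ => (labellingWeight_pos hK f).le

lemma sum_fiber_avoid {j : ℕ} {l : Label k n} (hl : l ∈ upperLabels k n j)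
    (hT : upperWeight k n K j ≠ 0) (ρ : Fin m → Option (Label k n)) (A : Finset (Fin m))
    (hA : ∀ e ∈ A, ρ e = none) :
    ∑ f with reveal j f = ρ ∧ ∀ e ∈ A, f e ≠ l, labellingWeight K f =
      (1 - labelWeight K l / upperWeight k n K j) ^ #A * fiberWeight K j ρ := by
  have key := sum_prod_avoid (labelWeight K)
    (fun e => ({l | revealBelow j l = ρ e} : Finset (Label k n))) hl hT A
    (fun e he => by simp only [hA e he, upperLabels])
  rw [← filter_filter, fiberWeight, fiber_reveal_eq]
  rw [sum_labelWeight_upperLabels] at key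
  simp only [prod_labelWeight] at key
  convert key

lemma sum_fiber_hit_le (hK : 1 ≤ K) {j : ℕ} (hjk : j ≤ k)
    (hT : K ^ j ≤ upperWeight k n K j) (ρ : Fin m → Option (Label k n)) (A : Finset (Fin m))
    (hA : ∀ e ∈ A, ρ e = none) :
    ∑ f with reveal j f = ρ ∧ ∀ l : Label k n, (l.1 : ℕ) = j → ∃ e ∈ A, f e = l,
      labellingWeight K f ≤
        (1 - (1 - K ^ j / upperWeight k n K j) ^ #A) ^ n * fiberWeight K j ρ := by
  have hKj : 0 < K ^ j := pow_pos (by linarith) j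
  have key := sum_prod_hit_le (labelWeight K) (fun l => (labelWeight_pos hK l).le)
    (hKj.trans_le hT) hKj.le A
    (fun e => ({l | revealBelow j l = ρ e} : Finset (Label k n))) (levelLabels k n j)
    (fun e he => by simp only [hA e he, upperLabels]) (levelLabels_subset j)
    (fun l hl => by rw [labelWeight, (mem_filter.1 hl).2]) hT
  rw [← filter_filter, fiberWeight, fiber_reveal_eq]
  rw [sum_labelWeight_upperLabels, card_levelLabels hjk] at key
  simp only [prod_labelWeight, levelLabels, mem_filter, mem_univ, true_and] at key
  convert key

/-- A union bound over labels: one of level at least `i` has relative weight at least `K ^ i /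
upperWeight k n K j` at each hidden position, and `1 - x ≤ exp (-x)`. -/
lemma sum_avoid_le (hK : 1 ≤ K) (hn : 0 < n) {j i : ℕ} (hjk : j ≤ k) (hji : j ≤ i)
    (ρ : Fin m → Option (Label k n)) (A : Finset (Fin m)) (hA : ∀ e ∈ A, ρ e = none) :
    ∑ f with reveal j f = ρ ∧ ∃ l : Label k n, i ≤ (l.1 : ℕ) ∧ ∀ e ∈ A, f e ≠ l,
      labellingWeight K f ≤
        (n * (k + 1)) * Real.exp (-(#A * K ^ i / upperWeight k n K j)) * fiberWeight K j ρ := by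
  have hT := upperWeight_pos (n := n) hK hjk hn
  have hone : ∀ l : Label k n, i ≤ (l.1 : ℕ) →
      ∑ f with reveal j f = ρ ∧ ∀ e ∈ A, f e ≠ l, labellingWeight K f ≤
        Real.exp (-(#A * K ^ i / upperWeight k n K j)) * fiberWeight K j ρ := by
    intro l hl
    have hmem : l ∈ upperLabels k n j := mem_upperLabels.2 (hji.trans hl)
    rw [sum_fiber_avoid hmem hT.ne' ρ A hA]
    refine mul_le_mul_of_nonneg_right ?_ (fiberWeight_nonneg hK j ρ)
    have hle : K ^ i / upperWeight k n K j ≤ labelWeight K l / upperWeight k n K j := by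
      gcongr
      exact pow_le_pow_right₀ hK hl
    have hle1 : labelWeight K l / upperWeight k n K j ≤ 1 :=
      (div_le_one hT).2 (single_le_sum (fun l _ => (labelWeight_pos hK l).le) hmem)
    calc (1 - labelWeight K l / upperWeight k n K j) ^ #A
        ≤ Real.exp (-(K ^ i / upperWeight k n K j)) ^ #A := by
          refine pow_le_pow_left₀ (sub_nonneg.2 hle1) ?_ _
          have := Real.add_one_le_exp (-(K ^ i / upperWeight k n K j))
          linarith
      _ = Real.exp (-(#A * K ^ i / upperWeight k n K j)) := by
          rw [← Real.exp_nat_mul]; congr 1; ring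
  calc ∑ f with reveal j f = ρ ∧ ∃ l : Label k n, i ≤ (l.1 : ℕ) ∧ ∀ e ∈ A, f e ≠ l,
        labellingWeight K f
      ≤ ∑ l : Label k n with i ≤ (l.1 : ℕ),
          ∑ f with reveal j f = ρ ∧ ∀ e ∈ A, f e ≠ l, labellingWeight K f := by
        refine sum_filter_le_sum_sum (fun f => (labellingWeight_pos hK f).le) fun f hf => ?_
        obtain ⟨h1, l, hl, h2⟩ := hf
        exact ⟨l, by simpa using hl, h1, h2⟩
    _ ≤ ∑ l : Label k n with i ≤ (l.1 : ℕ),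
          Real.exp (-(#A * K ^ i / upperWeight k n K j)) * fiberWeight K j ρ :=
        sum_le_sum fun l hl => hone l (mem_filter.1 hl).2
    _ ≤ ∑ l : Label k n, Real.exp (-(#A * K ^ i / upperWeight k n K j)) * fiberWeight K j ρ :=
        sum_le_sum_of_subset_of_nonneg (filter_subset _ _) fun _ _ _ =>
          mul_nonneg (Real.exp_pos _).le (fiberWeight_nonneg hK j ρ)
    _ = _ := by
        simp only [sum_const, card_univ, Fintype.card_prod, Fintype.card_fin, nsmul_eq_mul]
        push_cast
        ring

lemma exp_neg_two_mul_le {x : ℝ} (h0 : 0 ≤ x) (h1 : x ≤ 1 / 2) : Real.exp (-(2 * x)) ≤ 1 - x := by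
  rw [Real.exp_neg, inv_le_comm₀ (Real.exp_pos _) (by linarith)]
  calc (1 - x)⁻¹ ≤ 1 + 2 * x := by
        rw [inv_le_iff_one_le_mul₀ (by linarith)]; nlinarith
    _ ≤ _ := by have := Real.add_one_le_exp (2 * x); linarith

/-- Here `τ` bounds the expected number of positions of `A` carrying a given label of level `j`.
Each such label is missed with probability at least `exp (-2τ)`, and the `n` labels behave at best
as if independent. -/
lemma sum_hit_le (hK : 1 ≤ K) (hn : 2 ≤ n) {j : ℕ} (hjk : j ≤ k) {τ : ℝ}
    (ρ : Fin m → Option (Label k n)) (A : Finset (Fin m)) (hA : ∀ e ∈ A, ρ e = none)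
    (hτ : #A * K ^ j / upperWeight k n K j ≤ τ) :
    ∑ f with reveal j f = ρ ∧ ∀ l : Label k n, (l.1 : ℕ) = j → ∃ e ∈ A, f e = l,
      labellingWeight K f ≤ Real.exp (-(n * Real.exp (-(2 * τ)))) * fiberWeight K j ρ := by
  have hT := upperWeight_pos (n := n) hK hjk (by omega)
  have hKj : 0 < K ^ j := pow_pos (by linarith) j
  set x := K ^ j / upperWeight k n K j with hx
  have hx0 : 0 ≤ x := by positivity
  -- Two labels per level keep `x ≤ 1 / 2`, the range in which `exp (-2x) ≤ 1 - x`.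
  have hnT : 2 * K ^ j ≤ upperWeight k n K j := by
    refine le_trans ?_ (card_mul_le_upperWeight (n := n) hK j)
    gcongr
    exact_mod_cast hn.trans (le_card_upperLabels hjk)
  have hx2 : x ≤ 1 / 2 := by rw [hx, div_le_iff₀ hT]; linarith
  refine (sum_fiber_hit_le hK hjk (by linarith) ρ A hA).trans
    (mul_le_mul_of_nonneg_right ?_ (fiberWeight_nonneg hK j ρ))
  have h1 : Real.exp (-(2 * τ)) ≤ (1 - x) ^ #A :=
    calc Real.exp (-(2 * τ)) ≤ Real.exp (-(2 * x)) ^ #A := by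
          rw [← Real.exp_nat_mul, Real.exp_le_exp]
          rw [mul_div_assoc] at hτ
          linarith
      _ ≤ _ := pow_le_pow_left₀ (Real.exp_pos _).le (exp_neg_two_mul_le hx0 hx2) _
  calc (1 - (1 - x) ^ #A) ^ n ≤ Real.exp (-Real.exp (-(2 * τ))) ^ n := by
        refine pow_le_pow_left₀ (sub_nonneg.2 (pow_le_one₀ (by linarith) (by linarith))) ?_ _
        have := Real.add_one_le_exp (-Real.exp (-(2 * τ)))
        linarith
    _ = _ := by rw [← Real.exp_nat_mul]; congr 1; ring

/-! ### Unlikely outputs and predictable answers. -/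

/-- The positions outside `B` that are not yet revealed. -/
def hiddenOutside (ρ : Fin m → Option (Label k n)) (B : Finset (Fin m)) : Finset (Fin m) :=
  {e | ρ e = none ∧ e ∉ B}

lemma mem_hiddenOutside {ρ : Fin m → Option (Label k n)} {B : Finset (Fin m)} {e : Fin m} :
    e ∈ hiddenOutside ρ B ↔ ρ e = none ∧ e ∉ B := by simp [hiddenOutside]

lemma HitsOutside.exists_hidden {f : Fin m → Label k n} {B : Finset (Fin m)}
    (h : HitsOutside f B) {j : ℕ} {l : Label k n} (hl : j ≤ (l.1 : ℕ)) :
    ∃ e ∈ hiddenOutside (reveal j f) B, f e = l := by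
  obtain ⟨e, he, rfl⟩ := h l
  exact ⟨e, mem_hiddenOutside.2 ⟨revealBelow_eq_none.2 hl, he⟩, rfl⟩

/-- The hidden positions outside a basis carry distinct hidden labels, so there are at most as many
of them as hidden labels. Level `j` is the lightest hidden level, so each of its labels is then
expected at most once among them, and hitting them all is unlikely. -/
lemma sum_basis_le (hK : 1 ≤ K) (hn : 2 ≤ n) {j : ℕ} (hjk : j ≤ k)
    (ρ : Fin m → Option (Label k n)) (B : Finset (Fin m)) :
    ∑ f with reveal j f = ρ ∧ (HitsOutside f B ∧ ∀ e ∉ B, ∀ e' ∉ B, f e = f e' → e = e'),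
      labellingWeight K f ≤ Real.exp (-(n * Real.exp (-2))) * fiberWeight K j ρ := by
  have hT := upperWeight_pos (n := n) hK hjk (by omega)
  rcases le_or_gt #(hiddenOutside ρ B) #(upperLabels k n j) with hc | hc
  · have := sum_hit_le hK hn hjk (τ := 1) ρ (hiddenOutside ρ B)
      (fun e he => (mem_hiddenOutside.1 he).1) (by
        rw [div_le_one hT]
        refine le_trans ?_ (card_mul_le_upperWeight hK j)
        gcongr)
    rw [mul_one] at this
    refine le_trans (sum_le_sum_of_subset_of_nonneg (fun f hf => ?_)
      fun f _ _ => (labellingWeight_pos hK f).le) this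
    simp only [mem_filter, mem_univ, true_and] at hf ⊢
    obtain ⟨rfl, hf, -⟩ := hf
    exact ⟨rfl, fun l hl => hf.exists_hidden hl.ge⟩
  · rw [sum_eq_zero]
    · exact mul_nonneg (Real.exp_pos _).le (fiberWeight_nonneg hK j ρ)
    · intro f hf
      simp only [mem_filter, mem_univ, true_and] at hf
      obtain ⟨rfl, -, hf⟩ := hf
      refine absurd (card_le_card_of_injOn f (fun e he => ?_) fun e he e' he' => ?_) hc.not_ge
      · exact mem_upperLabels.2 (revealBelow_eq_none.1 (mem_hiddenOutside.1 he).1)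
      · exact hf e (mem_hiddenOutside.1 he).2 e' (mem_hiddenOutside.1 he').2

/-- The dichotomy is whether a label of weight `K ^ (j + 1)` is expected at least `τ` times among
the hidden positions outside `B`. If so, only levels up to `j` can be missed. If not, a label of
level `j` is expected fewer than `τ / K` times, and some such label is probably missed. -/
lemma exists_prediction (hK : 1 ≤ K) (hn : 2 ≤ n) {j : ℕ} (hjk : j ≤ k) {τ : ℝ}
    (ρ : Fin m → Option (Label k n)) (B : Finset (Fin m)) :
    ∃ a : (Fin m → Option (Label k n)) → Bool,
      ∑ f with reveal j f = ρ ∧ decide (HitsOutside f B) ≠ a (reveal (j + 1) f),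
        labellingWeight K f ≤
          (n * (k + 1) * Real.exp (-τ) + Real.exp (-(n * Real.exp (-(2 * (τ / K)))))) *
            fiberWeight K j ρ := by
  have hT := upperWeight_pos (n := n) hK hjk (by omega)
  have hW := fiberWeight_nonneg hK j ρ
  have hhid : ∀ e ∈ hiddenOutside ρ B, ρ e = none := fun e he => (mem_hiddenOutside.1 he).1
  rcases le_or_gt τ (#(hiddenOutside ρ B) * K ^ (j + 1) / upperWeight k n K j) with h | h
  · refine ⟨fun σ => decide (∀ l : Label k n, (l.1 : ℕ) < j + 1 → ∃ e ∉ B, σ e = some l), ?_⟩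
    calc _ ≤ ∑ f with reveal j f = ρ ∧
            ∃ l : Label k n, j + 1 ≤ (l.1 : ℕ) ∧ ∀ e ∈ hiddenOutside ρ B, f e ≠ l,
            labellingWeight K f := by
          refine sum_le_sum_of_subset_of_nonneg (fun f hf => ?_)
            fun f _ _ => (labellingWeight_pos hK f).le
          simp only [mem_filter, mem_univ, true_and] at hf ⊢
          obtain ⟨rfl, hf⟩ := hf
          refine ⟨rfl, ?_⟩
          by_contra! hall
          refine hf (decide_eq_decide.2 ⟨fun hf l hl => ?_, fun hf l => ?_⟩)
          · obtain ⟨e, he, hel⟩ := hf l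
            exact ⟨e, he, revealBelow_eq_some.2 ⟨hl, hel⟩⟩
          · rcases lt_or_ge (l.1 : ℕ) (j + 1) with hl | hl
            · obtain ⟨e, he, hel⟩ := hf l hl
              exact ⟨e, he, (revealBelow_eq_some.1 hel).2⟩
            · obtain ⟨e, he, hel⟩ := hall l hl
              exact ⟨e, (mem_hiddenOutside.1 he).2, hel⟩
      _ ≤ _ := sum_avoid_le hK (by omega) hjk (Nat.le_succ j) ρ _ hhid
      _ ≤ _ := by
          refine mul_le_mul_of_nonneg_right ?_ hW
          refine le_trans ?_ (le_add_of_nonneg_right (Real.exp_pos _).le)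
          gcongr
  · refine ⟨fun _ => false, ?_⟩
    calc _ ≤ ∑ f with reveal j f = ρ ∧
            ∀ l : Label k n, (l.1 : ℕ) = j → ∃ e ∈ hiddenOutside ρ B, f e = l,
            labellingWeight K f := by
          refine sum_le_sum_of_subset_of_nonneg (fun f hf => ?_)
            fun f _ _ => (labellingWeight_pos hK f).le
          simp only [mem_filter, mem_univ, true_and, ne_eq, decide_eq_false_iff_not,
            not_not] at hf ⊢
          obtain ⟨rfl, hf⟩ := hf
          exact ⟨rfl, fun l hl => hf.exists_hidden hl.ge⟩
      _ ≤ _ := sum_hit_le (τ := τ / K) hK hn hjk ρ _ hhid (by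
          rw [le_div_iff₀ (by linarith)]
          refine le_trans (le_of_eq ?_) h.le
          ring)
      _ ≤ _ := by
          refine mul_le_mul_of_nonneg_right ?_ hW
          exact le_add_of_nonneg_left (by positivity)

lemma sum_not_surjective_le (hK : 1 ≤ K) (hn : 0 < n) :
    ∑ f : Fin m → Label k n with ¬ Function.Surjective f, labellingWeight K f ≤
      n * (k + 1) * Real.exp (-(m / upperWeight k n K 0)) *
        ∑ f : Fin m → Label k n, labellingWeight K f := by
  have h0 : ∀ f : Fin m → Label k n, reveal 0 f = fun _ => none := fun f => by
    funext e; simp [reveal, revealBelow]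
  have := sum_avoid_le (j := 0) (i := 0) hK hn (Nat.zero_le k) le_rfl
    (fun _ : Fin m => (none : Option (Label k n))) univ (by simp)
  simpa [fiberWeight, h0, Function.Surjective] using this

/-- The failure probability of a round of `q` queries. -/
noncomputable def failureBound (K : ℝ) (k n q : ℕ) (τ : ℝ) : ℝ :=
  (q + 1) * (n * (k + 1) * Real.exp (-τ) + Real.exp (-(n * Real.exp (-(2 * (τ / K))))))

/-- Few rounds are unlikely to find a basis of the bundle matroid of a random labelling. -/
lemma sum_mul_truncSuccess_labelling_le (hK : 1 ≤ K) (hn : 2 ≤ n) {τ : ℝ} (hτ : K ≤ τ) {q : ℕ}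
    (H : DecisionTree m q) :
    ∑ f : Fin m → Label k n, ENNReal.ofReal (labellingWeight K f) *
      truncSuccess (fun B => decide (HitsOutside f B))
        (fun B => HitsOutside f B ∧ ∀ e ∉ B, ∀ e' ∉ B, f e = f e' → e = e') H k ≤
      ENNReal.ofReal ((k + 1) * failureBound K k n q τ) *
        ENNReal.ofReal (∑ f : Fin m → Label k n, labellingWeight K f) := by
  have hnn : ∀ f : Fin m → Label k n, 0 ≤ labellingWeight K f :=
    fun f => (labellingWeight_pos hK f).le
  have hε : 0 ≤ failureBound K k n q τ := by unfold failureBound; positivity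
  have hsum : ∀ s : Finset (Fin m → Label k n),
      ∑ f ∈ s, ENNReal.ofReal (labellingWeight K f) =
        ENNReal.ofReal (∑ f ∈ s, labellingWeight K f) := fun s =>
    (ENNReal.ofReal_sum_of_nonneg fun f _ => hnn f).symm
  have h0 : ∀ f : Fin m → Label k n, reveal 0 f = fun _ => none := fun f => by
    funext e; simp [reveal, revealBelow]
  have key := sum_mul_truncSuccess_le (fun f : Fin m → Label k n =>
      ENNReal.ofReal (labellingWeight K f)) (fun f B => decide (HitsOutside f B))
    (fun f B => HitsOutside f B ∧ ∀ e ∉ B, ∀ e' ∉ B, f e = f e' → e = e') reveal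
    (fun j f f' => reveal_eq_of_succ) k (ENNReal.ofReal (failureBound K k n q τ)) ?_ ?_ H k 0
    (fun _ => none) (zero_add k)
  · simp only [h0, filter_true, hsum] at key
    refine key.trans_eq ?_
    congr 1
    rw [ENNReal.ofReal_mul (by positivity)]
    congr 1
    rw [ENNReal.ofReal_add (by positivity) zero_le_one]
    simp
  · intro j hj ρ B
    rw [hsum, hsum, ← ENNReal.ofReal_mul hε]
    refine ENNReal.ofReal_le_ofReal ((sum_basis_le hK hn hj ρ B).trans
      (mul_le_mul_of_nonneg_right ?_ (fiberWeight_nonneg hK j ρ)))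
    calc Real.exp (-(n * Real.exp (-2)))
        ≤ Real.exp (-(n * Real.exp (-(2 * (τ / K))))) := by
          have : 1 ≤ τ / K := (one_le_div (by linarith)).2 hτ
          gcongr
          linarith
      _ ≤ n * (k + 1) * Real.exp (-τ) + Real.exp (-(n * Real.exp (-(2 * (τ / K))))) :=
          le_add_of_nonneg_left (by positivity)
      -- The `+ 1` in the factor `q + 1` keeps the bound valid at leaves even when `q = 0`.
      _ ≤ _ := le_mul_of_one_le_left (by positivity) (by simp)
  · intro j hj ρ B
    choose a ha using fun i => exists_prediction hK hn hj.le (τ := τ) ρ (B i)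
    refine ⟨fun σ i => a i σ, ?_⟩
    rw [hsum, hsum, ← ENNReal.ofReal_mul hε]
    refine ENNReal.ofReal_le_ofReal ?_
    calc _ ≤ ∑ i, ∑ f with reveal j f = ρ ∧
            decide (HitsOutside f (B i)) ≠ a i (reveal (j + 1) f), labellingWeight K f := by
          refine sum_filter_le_sum_sum hnn fun f ⟨h1, h2⟩ => ?_
          obtain ⟨i, hi⟩ := Function.ne_iff.1 h2
          exact ⟨i, mem_univ i, h1, hi⟩
      _ ≤ _ := sum_le_sum fun i _ => ha i
      _ ≤ _ := by
          rw [sum_const, card_univ, Fintype.card_fin, nsmul_eq_mul, ← mul_assoc]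
          refine mul_le_mul_of_nonneg_right ?_ (fiberWeight_nonneg hK j ρ)
          unfold failureBound
          gcongr
          linarith

end Levels
end CographicLB

namespace CographicLB

open Finset

/-! ### From truncated runs on random labellings to expected rounds on one matroid. -/

section Averaging

variable {k n m : ℕ} {K : ℝ}

lemma upperWeight_zero_le (hK : 1 ≤ K) : upperWeight k n K 0 ≤ n * (k + 1) * K ^ k := by
  have h := sum_le_card_nsmul (upperLabels k n 0) (labelWeight K) (K ^ k) fun l _ =>
    pow_le_pow_right₀ hK (by have := l.1.2; omega)
  have hc : #(upperLabels k n 0) ≤ (k + 1) * n := by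
    refine (card_le_univ _).trans_eq ?_
    simp
  rw [nsmul_eq_mul] at h
  refine h.trans (mul_le_mul_of_nonneg_right ?_ (by positivity))
  calc (#(upperLabels k n 0) : ℝ) ≤ ((k + 1) * n : ℕ) := by exact_mod_cast hc
    _ = _ := by push_cast; ring

lemma indOracle_bundleMatroid {f : Fin m → Label k n} (hf : Function.Surjective f) :
    indOracle (bundleMatroid f) = fun B => decide (HitsOutside f B) := by
  funext B
  exact decide_eq_decide.2 (bundleMatroid_indep_iff hf _)

lemma bundleMatroid_isBase_imp {f : Fin m → Label k n} (hf : Function.Surjective f)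
    {B : Finset (Fin m)} (hB : (bundleMatroid f).IsBase (B : Set (Fin m))) :
    HitsOutside f B ∧ ∀ e ∉ B, ∀ e' ∉ B, f e = f e' → e = e' :=
  ⟨(bundleMatroid_indep_iff hf _).1 hB.indep, fun _ he _ he' h =>
    injOn_compl_of_bundleMatroid_isBase hB he he' h⟩

/-- A success probability of `δ` on all cographic matroids forces many rounds on one of them. -/
lemma le_of_forall_expectedRounds_lt (hK : 1 ≤ K) (hn : 2 ≤ n) {τ : ℝ} (hτ : K ≤ τ) {q : ℕ}
    (H : DecisionTree m q) {δ X : ℝ} (hX : 0 ≤ X)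
    (hH : ∀ M : Matroid (Fin m), IsCographic M → ENNReal.ofReal δ ≤ successProb M H)
    (hE : ∀ M : Matroid (Fin m), IsCographic M → expectedRounds M H < ENNReal.ofReal X) :
    δ ≤ (k + 1) * failureBound K k n q τ +
      n * (k + 1) * Real.exp (-(m / upperWeight k n K 0)) + X / (k + 1) := by
  classical
  set W : (Fin m → Label k n) → ℝ := labellingWeight K with hW
  have hWpos : ∀ f, 0 < W f := labellingWeight_pos hK
  have : Nonempty (Fin n) := ⟨⟨0, by omega⟩⟩
  have htot : 0 < ∑ f, W f := sum_pos (fun f _ => hWpos f) univ_nonempty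
  have hfb : 0 ≤ failureBound K k n q τ := by unfold failureBound; positivity
  set S : (Fin m → Label k n) → ENNReal := fun f =>
    truncSuccess (fun B => decide (HitsOutside f B))
      (fun B => HitsOutside f B ∧ ∀ e ∉ B, ∀ e' ∉ B, f e = f e' → e = e') H k with hS
  -- A success comes from a run of at most `k` rounds, from a longer run (Markov), or from a
  -- non-surjective labelling, where `HitsOutside` need not describe the oracle.
  have hpt : ∀ f : Fin m → Label k n, ENNReal.ofReal δ ≤
      S f + (if ¬ Function.Surjective f then 1 else 0) + ENNReal.ofReal (X / (k + 1)) := by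
    intro f
    have hcog := isCographic_bundleMatroid f
    refine (hH _ hcog).trans ?_
    by_cases hf : Function.Surjective f
    · rw [if_neg (not_not.2 hf), add_zero]
      refine (successProb_le_truncSuccess_add_exceedProb _ H k).trans (add_le_add ?_ ?_)
      · rw [indOracle_bundleMatroid hf]
        exact truncSuccess_mono (fun B hB => bundleMatroid_isBase_imp hf hB) H k
      · rw [ENNReal.ofReal_div_of_pos (by positivity),
          ENNReal.le_div_iff_mul_le (Or.inl (by simp; positivity)) (Or.inl ENNReal.ofReal_ne_top),
          mul_comm]
        refine le_trans (le_of_eq ?_)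
          ((mul_exceedProb_le_expectedRounds _ H k).trans (hE _ hcog).le)
        rw [← Nat.cast_succ, ENNReal.ofReal_natCast]
    · rw [if_pos hf]
      exact (successProb_le_one _ _).trans (le_add_right le_add_self)
  have hsum : ENNReal.ofReal (δ * ∑ f, W f) ≤ ENNReal.ofReal
      ((k + 1) * failureBound K k n q τ * ∑ f, W f +
        n * (k + 1) * Real.exp (-(m / upperWeight k n K 0)) * ∑ f, W f +
          X / (k + 1) * ∑ f, W f) := by
    calc ENNReal.ofReal (δ * ∑ f, W f)
        = ∑ f, ENNReal.ofReal (W f) * ENNReal.ofReal δ := by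
          rw [← sum_mul, ← ENNReal.ofReal_sum_of_nonneg fun f _ => (hWpos f).le,
            ← ENNReal.ofReal_mul htot.le, mul_comm]
      _ ≤ ∑ f, ENNReal.ofReal (W f) * (S f + (if ¬ Function.Surjective f then 1 else 0) +
            ENNReal.ofReal (X / (k + 1))) :=
          sum_le_sum fun f _ => mul_le_mul_right (hpt f) _
      _ = ∑ f, ENNReal.ofReal (W f) * S f +
            ENNReal.ofReal (∑ f with ¬ Function.Surjective f, W f) +
              ENNReal.ofReal (X / (k + 1)) * ENNReal.ofReal (∑ f, W f) := by
          simp only [mul_add, sum_add_distrib, mul_ite, mul_one, mul_zero]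
          rw [← sum_filter, ← sum_mul, ← ENNReal.ofReal_sum_of_nonneg fun f _ => (hWpos f).le,
            ← ENNReal.ofReal_sum_of_nonneg fun f _ => (hWpos f).le,
            mul_comm (ENNReal.ofReal (X / (k + 1)))]
      _ ≤ _ := by
          rw [ENNReal.ofReal_add (by positivity) (by positivity),
            ENNReal.ofReal_add (by positivity) (by positivity),
            ENNReal.ofReal_mul (p := X / (k + 1)) (by positivity),
            ENNReal.ofReal_mul (p := (k + 1) * failureBound K k n q τ) (by positivity)]
          refine add_le_add (add_le_add (sum_mul_truncSuccess_labelling_le hK hn hτ H) ?_) le_rfl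
          refine ENNReal.ofReal_le_ofReal ?_
          convert sum_not_surjective_le (m := m) (k := k) hK (by omega : 0 < n)
  rw [ENNReal.ofReal_le_ofReal_iff (by positivity), ← add_mul, ← add_mul] at hsum
  exact le_of_mul_le_mul_right hsum htot

end Averaging

/-! ### Choice of the parameters -/

open Filter Topology in
/-- The asymptotic facts about `y = m ^ (1 / 8)` that the choice of parameters needs. -/
lemma eventually_parameters (c : ℝ) {η : ℝ} (hη : 0 < η) :
    ∀ᶠ y : ℝ in atTop, 3 ≤ y ∧ 8 * Real.log y + 1 ≤ y ∧
      2 / y + 2 * (y ^ (8 * c + 1) * Real.exp (-y)) + y ^ (5 : ℝ) * Real.exp (-y) < η := by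
  have h1 : Tendsto (fun y : ℝ => 2 / y + 2 * (y ^ (8 * c + 1) * Real.exp (-y)) +
      y ^ (5 : ℝ) * Real.exp (-y)) atTop (𝓝 (0 + 2 * 0 + 0)) := by
    have h := fun s : ℝ => tendsto_rpow_mul_exp_neg_mul_atTop_nhds_zero s 1 one_pos
    simp only [neg_mul, one_mul] at h
    exact ((tendsto_const_nhds.div_atTop tendsto_id).add ((h _).const_mul 2)).add (h _)
  have h2 := Real.isLittleO_log_id_atTop.bound (show (0 : ℝ) < 1 / 16 by norm_num)
  filter_upwards [h1.eventually_lt_const (by simpa using hη), h2, eventually_ge_atTop 3]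
    with y hy1 hy2 hy3
  refine ⟨hy3, ?_, hy1⟩
  simp only [id, Real.norm_eq_abs, abs_of_nonneg (by linarith : 0 ≤ y)] at hy2
  have := le_abs_self (Real.log y)
  linarith

/-- With `τ = (c + 4) log m`, the factor `exp (-τ)` beats the union bound over `q ≤ m ^ c` queries
and all labels. With `K = 8 (c + 4)`, `exp (-2τ / K) = m ^ (-1/4)`, so about `m ^ (1/4)` of the `√m`
labels of a level are expected to be missed. The bound on `k` gives `K ^ k ≤ m ^ (1/4)`, so even the
smallest bundles are nonempty with high probability. -/
lemma failure_lt {c η : ℝ} (hc : 0 < c) {y : ℝ} (hy3 : 3 ≤ y) (hylog : 8 * Real.log y + 1 ≤ y)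
    (hyη : 2 / y + 2 * (y ^ (8 * c + 1) * Real.exp (-y)) + y ^ (5 : ℝ) * Real.exp (-y) < η)
    {m q k n : ℕ} (hm : (m : ℝ) = y ^ 8) (hq : (q : ℝ) ≤ (m : ℝ) ^ c)
    (hk : (k : ℝ) ≤ Real.log m / (4 * Real.log (8 * (c + 4)))) (hn : n = Nat.sqrt m) :
    2 ≤ n ∧ (k + 1) * failureBound (8 * (c + 4)) k n q ((c + 4) * Real.log m) +
      n * (k + 1) * Real.exp (-(m / upperWeight k n (8 * (c + 4)) 0)) < η := by
  have hy0 : 0 < y := by linarith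
  set K := 8 * (c + 4) with hKdef
  have hK : 1 ≤ K := by rw [hKdef]; linarith
  have hKe : Real.exp 1 ≤ K := by have := Real.exp_one_lt_d9; rw [hKdef]; linarith
  have hlogK : 1 ≤ Real.log K := (Real.le_log_iff_exp_le (by linarith)).2 hKe
  have hlogy : 0 ≤ Real.log y := Real.log_nonneg (by linarith)
  have hlogm : Real.log m = 8 * Real.log y := by rw [hm, Real.log_pow]; norm_num
  -- the number of levels
  have hk' : k * Real.log K ≤ 2 * Real.log y := by
    rw [le_div_iff₀ (by linarith), hlogm] at hk
    linarith
  have hky : (k : ℝ) + 1 ≤ y := by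
    have : (k : ℝ) * 1 ≤ k * Real.log K := by gcongr
    linarith
  have hKk : K ^ k ≤ y ^ 2 := by
    rw [← Real.log_le_log_iff (by positivity) (by positivity), Real.log_pow, Real.log_pow]
    exact_mod_cast hk'
  -- the number of labels in a level
  have hny : (n : ℝ) ≤ y ^ 4 := by
    have : (n : ℝ) ^ 2 ≤ (y ^ 4) ^ 2 := by
      rw [← pow_mul, ← hm, hn]
      exact_mod_cast Nat.sqrt_le' m
    exact le_of_sq_le_sq this (by positivity)
  have hyn : y ^ 4 < n + 1 := by
    have : (y ^ 4) ^ 2 < ((n : ℝ) + 1) ^ 2 := by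
      rw [← pow_mul, ← hm, hn]
      exact_mod_cast Nat.lt_succ_sqrt' m
    exact lt_of_pow_lt_pow_left₀ 2 (by positivity) this
  have hy4 : 81 ≤ y ^ 4 := by
    calc (81 : ℝ) = 3 ^ 4 := by norm_num
      _ ≤ y ^ 4 := by gcongr
  have hn2 : 2 ≤ n := by
    have : (1 : ℝ) < n := by linarith
    exact_mod_cast this
  refine ⟨hn2, ?_⟩
  have hyn' : y ^ 4 / 2 ≤ n := by linarith
  -- the query bound
  set Q := (m : ℝ) ^ c with hQ
  have hm1 : (1 : ℝ) ≤ m := by rw [hm]; exact one_le_pow₀ (by linarith)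
  have hQ1 : 1 ≤ Q := Real.one_le_rpow hm1 hc.le
  have hQy : Q * y = y ^ (8 * c + 1) := by
    rw [Real.rpow_add hy0, Real.rpow_one, hQ, hm, Real.rpow_mul hy0.le]
    norm_cast
  have hq1 : (q : ℝ) + 1 ≤ 2 * Q := by linarith
  have hexp1 : Real.exp (-((c + 4) * Real.log m)) = 1 / (Q * y ^ 32) := by
    have hm0 : (0 : ℝ) < m := by linarith
    have : Real.exp ((c + 4) * Real.log m) = Q * y ^ 32 := by
      rw [add_mul, Real.exp_add, hQ, Real.rpow_def_of_pos hm0, mul_comm c]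
      congr 1
      rw [show (4 : ℝ) * Real.log m = (4 : ℕ) * Real.log m by norm_num, Real.exp_nat_mul,
        Real.exp_log hm0, hm, ← pow_mul]
    rw [Real.exp_neg, this, one_div]
  have hexp2 : Real.exp (-(n * Real.exp (-(2 * ((c + 4) * Real.log m / K))))) ≤ Real.exp (-y) := by
    have h1 : 2 * ((c + 4) * Real.log m / K) = (2 : ℕ) * Real.log y := by
      rw [hlogm, hKdef]
      have : c + 4 ≠ 0 := by linarith
      push_cast
      field_simp
    have h2 : Real.exp (-((2 : ℕ) * Real.log y)) = (y ^ 2)⁻¹ := by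
      rw [Real.exp_neg, Real.exp_nat_mul, Real.exp_log hy0]
    rw [h1, h2, Real.exp_le_exp, neg_le_neg_iff,
      ← div_eq_mul_inv, le_div_iff₀ (by positivity)]
    nlinarith [pow_pos hy0 3]
  have hexp3 : Real.exp (-(m / upperWeight k n K 0)) ≤ Real.exp (-y) := by
    have hT := upperWeight_pos (n := n) hK (Nat.zero_le k) (by omega)
    rw [Real.exp_le_exp, neg_le_neg_iff, le_div_iff₀ hT, hm]
    calc y * upperWeight k n K 0 ≤ y * (n * (k + 1) * K ^ k) := by
          gcongr
          exact upperWeight_zero_le hK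
      _ ≤ y * (y ^ 4 * y * y ^ 2) := by gcongr
      _ = y ^ 8 := by ring
  have hy25 : 2 / y ^ 26 ≤ 2 / y := by
    gcongr
    exact le_self_pow₀ (by linarith) (by norm_num)
  calc (k + 1) * failureBound K k n q ((c + 4) * Real.log m) +
        n * (k + 1) * Real.exp (-(m / upperWeight k n K 0))
      ≤ y * ((2 * Q) * (y ^ 4 * y * (1 / (Q * y ^ 32)) + Real.exp (-y))) +
          y ^ 4 * y * Real.exp (-y) := by
        unfold failureBound
        rw [hexp1]
        gcongr
    _ = 2 / y ^ 26 + 2 * (Q * y * Real.exp (-y)) + y ^ 5 * Real.exp (-y) := by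
        field_simp
    _ ≤ 2 / y + 2 * (y ^ (8 * c + 1) * Real.exp (-y)) + y ^ (5 : ℝ) * Real.exp (-y) := by
        rw [hQy]
        gcongr
        exact le_of_eq (by norm_cast)
    _ < η := hyη

end CographicLB

theorem mainTheorem6 (c : ℝ) (hc : 0 < c) (δ : ℝ) (hδ : 0 < δ) :
    ∃ a : ℝ, 0 < a ∧ ∃ m₀ : ℕ, ∀ m : ℕ, m₀ ≤ m → ∀ q : ℕ, (q : ℝ) ≤ (m : ℝ) ^ c →
      ∀ H : CographicLB.DecisionTree m q,
        (∀ M : Matroid (Fin m), CographicLB.IsCographic M →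
          ENNReal.ofReal δ ≤ CographicLB.successProb M H) →
        ∃ M : Matroid (Fin m), CographicLB.IsCographic M ∧
          ENNReal.ofReal (a * Real.log m) ≤ CographicLB.expectedRounds M H := by
  have hlogK : 0 < Real.log (8 * (c + 4)) := Real.log_pos (by linarith)
  refine ⟨δ / (8 * Real.log (8 * (c + 4))), by positivity, ?_⟩
  have hev : ∀ᶠ m : ℕ in Filter.atTop, _ :=
    ((tendsto_rpow_atTop (show (0 : ℝ) < 1 / 8 by norm_num)).comp
      tendsto_natCast_atTop_atTop).eventually
      (CographicLB.eventually_parameters c (half_pos hδ))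
  obtain ⟨m₀, hm₀⟩ := Filter.eventually_atTop.1 hev
  refine ⟨m₀, fun m hm q hq H hH => ?_⟩
  obtain ⟨hy3, hylog, hyη⟩ := hm₀ m hm
  simp only [Function.comp_apply] at hy3 hylog hyη
  set y := (m : ℝ) ^ (1 / 8 : ℝ) with hy
  have hmy : (m : ℝ) = y ^ 8 := by
    rw [hy, ← Real.rpow_natCast, ← Real.rpow_mul (Nat.cast_nonneg m)]
    norm_num
  have hlogm : Real.log m = 8 * Real.log y := by rw [hmy, Real.log_pow]; norm_num
  have hlogy : 1 ≤ Real.log y :=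
    (Real.le_log_iff_exp_le (by linarith)).2 (by have := Real.exp_one_lt_d9; linarith)
  set k := ⌊Real.log m / (4 * Real.log (8 * (c + 4)))⌋₊ with hk
  obtain ⟨hn2, hfail⟩ := CographicLB.failure_lt hc hy3 hylog hyη hmy hq
    (k := k) (Nat.floor_le (div_nonneg (by linarith) (by linarith))) rfl
  by_contra! hE
  have hbound := CographicLB.le_of_forall_expectedRounds_lt (k := k) (K := 8 * (c + 4))
    (τ := (c + 4) * Real.log m) (by linarith) hn2 (by rw [hlogm]; nlinarith) H
    (mul_nonneg (by positivity) (by linarith)) hH hE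
  -- Since `k + 1` is at least `log m / (4 log K)`, the constant `δ / (8 log K)` makes the Markov
  -- term at most `δ / 2`; the other error terms sum to less than `δ / 2`.
  have hrounds : δ / (8 * Real.log (8 * (c + 4))) * Real.log m / (k + 1) ≤ δ / 2 := by
    have hlt := (Nat.lt_floor_add_one (Real.log m / (4 * Real.log (8 * (c + 4))))).le
    rw [← hk, div_le_iff₀ (by positivity)] at hlt
    rw [div_le_iff₀ (by positivity), div_mul_eq_mul_div, div_le_iff₀ (by positivity)]
    nlinarith
  linarith
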